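/- Let $\tilde a,a\in\mathbb R^{s\times s}$ and $\tilde\omega,\omega\in\mathbb R^s$ be the coefficients of an $s$-stage IMEX Runge–Kutta method: $\tilde a_{ij}=0$ for $j\ge i$, $a_{ij}=0$ for $j>i$, and all weights $\tilde\omega_i,\omega_i$ are non-zero. For smooth $f,g:\mathbb R^m\to\mathbb R^m$ and a step size $h>0$, the forward scheme for $y'=f(y)+g(y)$ is $$Y^{(i)}=y_n+h\sum_j\tilde a_{ij}f(Y^{(j)})+h\sum_j a_{ij}g(Y^{(j)}),\qquad y_{n+1}=y_n+h\sum_i\tilde\omega_i f(Y^{(i)})+h\sum_i\omega_i g(Y^{(i)}).$$ Put $\tilde\alpha_{ij}=\tilde\omega_j-\frac{\tilde\omega_j}{\tilde\omega_i}\tilde a_{ji}$, $\alpha_{ij}=\omega_j-\frac{\omega_j}{\tilde\omega_i}\tilde a_{ji}$, $\tilde\beta_{ij}=\tilde\omega_j-\frac{\tilde\omega_j}{\omega_i}a_{ji}$, $\beta_{ij}=\omega_j-\frac{\omega_j}{\omega_i}a_{ji}$, $\gamma_i=\sum_j\alpha_{ij}$ and $\tilde\gamma_i=\sum_j\tilde\alpha_{ij}$.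 The combined scheme consists of the forward scheme and of $$\tilde P^{(i)}=\tilde p_n-h\sum_j\tilde\alpha_{ij}f'(Y^{(j)})^T\tilde P^{(j)}-h\sum_j\alpha_{ij}g'(Y^{(j)})^TP^{(j)},$$ $$P^{(i)}=p_n-h\sum_j\tilde\beta_{ij}f'(Y^{(j)})^T\tilde P^{(j)}-h\sum_j\beta_{ij}g'(Y^{(j)})^TP^{(j)},$$ $$p_{n+1}=p_n-h\,\Delta,\qquad \tilde p_{n+1}=\tilde p_n-h\,\Delta,\qquad \Delta=\sum_i\tilde\omega_if'(Y^{(i)})^T\tilde P^{(i)}+\sum_i\omega_ig'(Y^{(i)})^TP^{(i)},$$ as a discretization of $y'=f(y)+g(y)$, $\tilde p'=p'=-f'(y)^T\tilde p-g'(y)^Tp$. (If $\tilde p_0=p_0$, then $\tilde p_n=p_n$ for all $n$, and this is the adjoint scheme obtained by discretizing first and then optimizing.) A scheme has order $q$ if, for all $m$, all smooth $f,g$ and every exact solution, the following holds in every ball around the initial state: for all sufficiently small $h>0$ one step with its forward stages in that ball exists, and every such step has an error $O(h^{q+1})$ in all its components. Then: 1. The combined scheme has first order if the forward scheme has first order.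 2. The combined scheme has second order if the forward scheme has second order. 3. The combined scheme has third order if the forward scheme has third order and either $$\sum_i\omega_i\gamma_i^2=\sum_i\omega_i\tilde\gamma_i^2=\sum_i\omega_i\gamma_i\tilde\gamma_i=\tfrac13,$$ or $$\sum_{i,j}\omega_ia_{ij}\gamma_j=\tfrac16,\qquad \sum_{i,j}\omega_i\tilde a_{ij}\tilde\gamma_j=\tfrac16,\qquad\text{and}\qquad \sum_{i,j}\omega_ia_{ij}\tilde\gamma_j=\tfrac16\ \text{ or }\ \sum_{i,j}\omega_i\tilde a_{ij}\gamma_j=\tfrac16 .$$ -/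

import Mathlib

open Set Filter Topology
open scoped ContDiff

/-- Coefficients of an implicit-explicit (additive) Runge–Kutta method with `s` stages.
`aE`, `wE` are the coefficients `ã`, `ω̃` of the explicit part and `aI`, `wI` the coefficients
`a`, `ω` of the (diagonally) implicit part. -/
structure IMEXTableau (s : ℕ) where
  aE : Matrix (Fin s) (Fin s) ℝ
  aI : Matrix (Fin s) (Fin s) ℝ
  wE : Fin s → ℝ
  wI : Fin s → ℝ
  explicit : ∀ i j, i ≤ j → aE i j = 0
  diagonally_implicit : ∀ i j, i < j → aI i j = 0

/-- The state space `ℝᵐ` with its Euclidean inner product. -/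
abbrev StateSpace (m : ℕ) : Type := EuclideanSpace ℝ (Fin m)

namespace IMEXTableau

noncomputable section

variable {s m : ℕ} (M : IMEXTableau s)

/-! ### Coefficients of the adjoint scheme -/

/-- `α̃ i j = ω̃ j - (ω̃ j / ω̃ i) ã j i` -/
def alphaE (i j : Fin s) : ℝ := M.wE j - M.wE j / M.wE i * M.aE j i

/-- `α i j = ω j - (ω j / ω̃ i) ã j i` -/
def alphaI (i j : Fin s) : ℝ := M.wI j - M.wI j / M.wE i * M.aE j i

/-- `β̃ i j = ω̃ j - (ω̃ j / ω i) a j i` -/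
def betaE (i j : Fin s) : ℝ := M.wE j - M.wE j / M.wI i * M.aI j i

/-- `β i j = ω j - (ω j / ω i) a j i` -/
def betaI (i j : Fin s) : ℝ := M.wI j - M.wI j / M.wI i * M.aI j i

/-- `γ̃ i = ∑ j, α̃ i j` -/
def gammaE (i : Fin s) : ℝ := ∑ j, M.alphaE i j

/-- `γ i = ∑ j, α i j` -/
def gammaI (i : Fin s) : ℝ := ∑ j, M.alphaI i j

/-! ### The forward scheme for `y' = f(y) + g(y)` -/

/-- `Y` are stage values of one step of size `h` from `y₀`; `f` is treated explicitly and `g`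
implicitly. -/
def IsForwardStages (f g : StateSpace m → StateSpace m) (h : ℝ) (y₀ : StateSpace m)
    (Y : Fin s → StateSpace m) : Prop :=
  ∀ i, Y i = y₀ + h • ∑ j, M.aE i j • f (Y j) + h • ∑ j, M.aI i j • g (Y j)

/-- The new value of the state computed from the stage values `Y`. -/
def forwardUpdate (f g : StateSpace m → StateSpace m) (h : ℝ) (y₀ : StateSpace m)
    (Y : Fin s → StateSpace m) : StateSpace m :=
  y₀ + h • ∑ i, M.wE i • f (Y i) + h • ∑ i, M.wI i • g (Y i)

/-- `y` solves `y' = f(y) + g(y)` on `[0, T]`. -/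
def IsForwardSolution (f g : StateSpace m → StateSpace m) (T : ℝ) (y : ℝ → StateSpace m) : Prop :=
  ∀ t ∈ Icc 0 T, HasDerivWithinAt y (f (y t) + g (y t)) (Icc 0 T) t

/-- The forward scheme has order (at least) `q`: for all smooth right-hand sides in all dimensions,
one step of small size `h > 0` from a point of an exact solution can be carried out with stages in
a given neighbourhood of that point, and every such step has an error `O(h ^ (q + 1))`. -/
def ForwardHasOrder (q : ℕ) : Prop :=
  ∀ (m : ℕ) (f g : StateSpace m → StateSpace m), ContDiff ℝ ∞ f → ContDiff ℝ ∞ g →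
    ∀ (T : ℝ) (y : ℝ → StateSpace m), 0 < T → IsForwardSolution f g T y →
      ∀ r > 0, ∃ C : ℝ, ∀ᶠ h in 𝓝[>] (0 : ℝ),
        (∃ Y : Fin s → StateSpace m,
          M.IsForwardStages f g h (y 0) Y ∧ ∀ i, Y i ∈ Metric.ball (y 0) r) ∧
        ∀ Y : Fin s → StateSpace m,
          M.IsForwardStages f g h (y 0) Y → (∀ i, Y i ∈ Metric.ball (y 0) r) →
            ‖M.forwardUpdate f g h (y 0) Y - y h‖ ≤ C * h ^ (q + 1)

/-! ### The combined scheme for the state `y` and the adjoint variables `p̃`, `p` -/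

/-- The transposed Jacobian `f'(y)ᵀ` applied to `p`. -/
def adjD (f : StateSpace m → StateSpace m) (y p : StateSpace m) : StateSpace m :=
  ContinuousLinearMap.adjoint (fderiv ℝ f y) p

/-- `Pt`, `P` are adjoint stage values of one step of size `h`, along the state stages `Y`. The
stages `Pt` belong to the variable `p̃` and the stages `P` to `p`; if the step starts from
`p̃₀ = p₀`, both kinds of stages start from `p₀`, and then `p̃ = p` holds after the step too. -/
def IsAdjointStages (f g : StateSpace m → StateSpace m) (h : ℝ) (pt₀ p₀ : StateSpace m)
    (Y Pt P : Fin s → StateSpace m) : Prop :=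
  (∀ i, Pt i = pt₀ - h • ∑ j, M.alphaE i j • adjD f (Y j) (Pt j)
      - h • ∑ j, M.alphaI i j • adjD g (Y j) (P j)) ∧
  (∀ i, P i = p₀ - h • ∑ j, M.betaE i j • adjD f (Y j) (Pt j)
      - h • ∑ j, M.betaI i j • adjD g (Y j) (P j))

/-- The new value of an adjoint variable with old value `p₀`; the formula is the same for `p`
and for `p̃`. -/
def adjointUpdate (f g : StateSpace m → StateSpace m) (h : ℝ) (p₀ : StateSpace m)
    (Y Pt P : Fin s → StateSpace m) : StateSpace m :=
  p₀ - h • ∑ i, M.wE i • adjD f (Y i) (Pt i) - h • ∑ i, M.wI i • adjD g (Y i) (P i)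

/-- `(y, p̃, p)` solves `y' = f(y) + g(y)`, `p̃' = p' = - f'(y)ᵀ p̃ - g'(y)ᵀ p` on `[0, T]`. -/
def IsCombinedSolution (f g : StateSpace m → StateSpace m) (T : ℝ)
    (y pt p : ℝ → StateSpace m) : Prop :=
  IsForwardSolution f g T y ∧
  (∀ t ∈ Icc 0 T,
    HasDerivWithinAt pt (-adjD f (y t) (pt t) - adjD g (y t) (p t)) (Icc 0 T) t) ∧
  (∀ t ∈ Icc 0 T,
    HasDerivWithinAt p (-adjD f (y t) (pt t) - adjD g (y t) (p t)) (Icc 0 T) t)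

/-- The combined scheme has order (at least) `q`, in the same sense as the forward scheme. The
adjoint stages solve a linear system, so they need not be localized. -/
def CombinedHasOrder (q : ℕ) : Prop :=
  ∀ (m : ℕ) (f g : StateSpace m → StateSpace m), ContDiff ℝ ∞ f → ContDiff ℝ ∞ g →
    ∀ (T : ℝ) (y pt p : ℝ → StateSpace m), 0 < T → IsCombinedSolution f g T y pt p →
      ∀ r > 0, ∃ C : ℝ, ∀ᶠ h in 𝓝[>] (0 : ℝ),
        (∃ Y Pt P : Fin s → StateSpace m,
          M.IsForwardStages f g h (y 0) Y ∧ (∀ i, Y i ∈ Metric.ball (y 0) r) ∧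
          M.IsAdjointStages f g h (pt 0) (p 0) Y Pt P) ∧
        ∀ Y Pt P : Fin s → StateSpace m,
          M.IsForwardStages f g h (y 0) Y → (∀ i, Y i ∈ Metric.ball (y 0) r) →
          M.IsAdjointStages f g h (pt 0) (p 0) Y Pt P →
            ‖M.forwardUpdate f g h (y 0) Y - y h‖ ≤ C * h ^ (q + 1) ∧
            ‖M.adjointUpdate f g h (pt 0) Y Pt P - pt h‖ ≤ C * h ^ (q + 1) ∧
            ‖M.adjointUpdate f g h (p 0) Y Pt P - p h‖ ≤ C * h ^ (q + 1)

end

end IMEXTableau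

/-! With `A = f'ᵀ`, `B = g'ᵀ`, the difference `d = p̃ - p` is constant. Let `W' = W (A(y) + B(y))`,
`W(0) = id`, and `z' = W A(y) d`, `z(0) = 0`. Then `W p + z` is a first integral of the adjoint
equation, equal to `p(0)`.

The coefficients of the adjoint scheme are those for which the discrete step conserves the same
quantity exactly, provided that `W` and `z` are computed by the forward scheme
(`adjoint_pairing_eq`). But `(y, W, z)` solves an additive ODE with explicit part `(f, W A, W A d)`
and implicit part `(g, W B, 0)`. Since forward order `q` concerns all smooth right-hand sides in all
dimensions, it applies to this system, and `W` and `z` have errors `O(h^(q+1))`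
(`exists_augmented_error`). Subtracting the two conservation laws and inverting the numerical `W`,
which is close to `id`, gives the same bound for `p`, hence for `p̃`. The argument is uniform in
`q`. -/

/-- A linear fixed-point equation with a contraction has a solution, which is bounded by the data. -/
theorem LinearMap.exists_eq_add_smul_of_norm_le {V : Type*} [NormedAddCommGroup V] [NormedSpace ℝ V]
    [FiniteDimensional ℝ V] (T : V →ₗ[ℝ] V) {κ h : ℝ} (hT : ∀ x, ‖T x‖ ≤ κ * ‖x‖) (hh : 0 ≤ h)
    (hκ : h * κ ≤ 1 / 2) (b : V) : ∃ x, x = b + h • T x ∧ ‖x‖ ≤ 2 * ‖b‖ := by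
  have bound : ∀ x, ‖h • T x‖ ≤ 1 / 2 * ‖x‖ := fun x => by
    rw [norm_smul, Real.norm_of_nonneg hh]
    calc h * ‖T x‖ ≤ h * (κ * ‖x‖) := by gcongr; exact hT x
      _ = h * κ * ‖x‖ := by ring
      _ ≤ _ := by gcongr
  have inj : Function.Injective ((LinearMap.id : V →ₗ[ℝ] V) - h • T) := by
    rw [injective_iff_map_eq_zero]
    intro x hx
    have h1 : x = h • T x := by simpa [sub_eq_zero] using hx
    have h2 := bound x
    rw [← h1] at h2
    exact norm_le_zero_iff.1 (by linarith)
  obtain ⟨x, hx⟩ := LinearMap.surjective_of_injective inj b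
  have hx' : x = b + h • T x := by
    rw [← hx]; simp
  refine ⟨x, hx', ?_⟩
  have h1 : ‖x‖ ≤ ‖b‖ + ‖h • T x‖ := by
    conv_lhs => rw [hx']
    exact norm_add_le _ _
  linarith [bound x]

/-! ### Change of coordinates and the discrete conservation law -/

namespace IMEXTableau

variable {s : ℕ}

/-- The error bound of a scheme of order `q` for an ODE in an arbitrary finite-dimensional space. -/
theorem ForwardHasOrder.exists_norm_sub_le {M : IMEXTableau s} {q : ℕ} (hM : M.ForwardHasOrder q)
    {X : Type*} [NormedAddCommGroup X] [NormedSpace ℝ X] [FiniteDimensional ℝ X] {f g : X → X}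
    (hf : ContDiff ℝ ∞ f) (hg : ContDiff ℝ ∞ g) {T : ℝ} (hT : 0 < T) {x : ℝ → X}
    (hx : ∀ t ∈ Icc 0 T, HasDerivWithinAt x (f (x t) + g (x t)) (Icc 0 T) t) (R : ℝ) :
    ∃ C : ℝ, ∀ᶠ h in 𝓝[>] (0 : ℝ), ∀ Z : Fin s → X,
      (∀ i, Z i = x 0 + h • ∑ j, M.aE i j • f (Z j) + h • ∑ j, M.aI i j • g (Z j)) →
      (∀ i, ‖Z i - x 0‖ ≤ R) →
        ‖x 0 + h • ∑ i, M.wE i • f (Z i) + h • ∑ i, M.wI i • g (Z i) - x h‖ ≤ C * h ^ (q + 1) := by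
  -- Runge–Kutta steps commute with linear coordinate changes, so only the constant is affected.
  have e : X ≃L[ℝ] StateSpace (Module.finrank ℝ X) :=
    ContinuousLinearEquiv.ofFinrankEq (by simp)
  have hf' : ContDiff ℝ ∞ (fun u => e (f (e.symm u))) :=
    e.contDiff.comp (hf.comp e.symm.contDiff)
  have hg' : ContDiff ℝ ∞ (fun u => e (g (e.symm u))) :=
    e.contDiff.comp (hg.comp e.symm.contDiff)
  have hx' : IsForwardSolution (fun u => e (f (e.symm u))) (fun u => e (g (e.symm u))) T
      (fun t => e (x t)) := fun t ht => by
    have := e.hasFDerivAt.comp_hasDerivWithinAt t (hx t ht)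
    simpa [Function.comp_def] using this
  have hr : 0 < ‖(e : X →L[ℝ] StateSpace (Module.finrank ℝ X))‖ * |R| + 1 := by positivity
  obtain ⟨C, hC⟩ := hM _ _ _ hf' hg' T _ hT hx' _ hr
  refine ⟨‖(e.symm : StateSpace (Module.finrank ℝ X) →L[ℝ] X)‖ * C, ?_⟩
  filter_upwards [hC] with h hh Z hZ hR
  have key := hh.2 (fun i => e (Z i))
    (fun i => by
      have := congrArg e (hZ i)
      simpa [map_sum] using this)
    (fun i => by
      rw [mem_ball_iff_norm, ← map_sub]
      have h1 := (e : X →L[ℝ] StateSpace (Module.finrank ℝ X)).le_opNorm (Z i - x 0)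
      have h2 : ‖(e : X →L[ℝ] StateSpace (Module.finrank ℝ X))‖ * ‖Z i - x 0‖ ≤
          ‖(e : X →L[ℝ] StateSpace (Module.finrank ℝ X))‖ * |R| := by
        gcongr; exact (hR i).trans (le_abs_self R)
      exact lt_of_le_of_lt (h1.trans h2) (by linarith))
  set u := x 0 + h • ∑ i, M.wE i • f (Z i) + h • ∑ i, M.wI i • g (Z i) - x h with hu
  have hue : M.forwardUpdate (fun u => e (f (e.symm u))) (fun u => e (g (e.symm u))) h (e (x 0))
      (fun i => e (Z i)) - e (x h) = e u := by
    simp [hu, forwardUpdate, map_sum]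
  rw [hue] at key
  have h1 := (e.symm : StateSpace (Module.finrank ℝ X) →L[ℝ] X).le_opNorm (e u)
  calc ‖u‖ = ‖e.symm (e u)‖ := by simp
    _ ≤ ‖(e.symm : StateSpace (Module.finrank ℝ X) →L[ℝ] X)‖ * ‖e u‖ := h1
    _ ≤ ‖(e.symm : StateSpace (Module.finrank ℝ X) →L[ℝ] X)‖ * (C * h ^ (q + 1)) := by gcongr
    _ = _ := by ring

/-- The adjoint scheme preserves the pairing of the adjoint variable with the fundamental matrix
computed by the forward scheme. -/
theorem adjoint_pairing_eq (M : IMEXTableau s) (hwE : ∀ i, M.wE i ≠ 0) (hwI : ∀ i, M.wI i ≠ 0)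
    {E : Type*} [NormedAddCommGroup E] [NormedSpace ℝ E] {A B W : Fin s → E →L[ℝ] E}
    {W₀ : E →L[ℝ] E} {Pt P : Fin s → E} {p₀ d : E} {h : ℝ}
    (hW : ∀ i, W i = W₀ + h • ∑ j, M.aE i j • (W j ∘L A j) + h • ∑ j, M.aI i j • (W j ∘L B j))
    (hPt : ∀ i, Pt i = p₀ + d - h • ∑ j, M.alphaE i j • A j (Pt j)
      - h • ∑ j, M.alphaI i j • B j (P j))
    (hP : ∀ i, P i = p₀ - h • ∑ j, M.betaE i j • A j (Pt j)
      - h • ∑ j, M.betaI i j • B j (P j)) :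
    (W₀ + h • ∑ i, M.wE i • (W i ∘L A i) + h • ∑ i, M.wI i • (W i ∘L B i))
        (p₀ - h • ∑ i, M.wE i • A i (Pt i) - h • ∑ i, M.wI i • B i (P i))
      + h • ∑ i, M.wE i • W i (A i d) = W₀ p₀ := by
  set D : Fin s → E := fun i => M.wE i • A i (Pt i) + M.wI i • B i (P i) with hD
  set p₁ : E := p₀ - h • ∑ i, D i with hp₁
  have hp₁' : p₀ - h • ∑ i, M.wE i • A i (Pt i) - h • ∑ i, M.wI i • B i (P i) = p₁ := by
    rw [hp₁, hD, Finset.sum_add_distrib, smul_add, sub_sub]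
  -- Seen from the end `p₁` of the step and scaled by the weight, the adjoint stages carry the
  -- transposed forward matrix.
  have hPt' : ∀ i, M.wE i • Pt i = M.wE i • (p₁ + d) + h • ∑ j, M.aE j i • D j := by
    intro i
    have h1 : ∀ j, M.wE i • (M.alphaE i j • A j (Pt j) + M.alphaI i j • B j (P j))
        = M.wE i • D j - M.aE j i • D j := by
      intro j
      simp only [hD, alphaE, alphaI]
      match_scalars <;> field_simp [hwE i]
    have h2 : M.wE i • ((∑ j, M.alphaE i j • A j (Pt j)) + ∑ j, M.alphaI i j • B j (P j))
        = M.wE i • (∑ j, D j) - ∑ j, M.aE j i • D j := by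
      rw [← Finset.sum_add_distrib, Finset.smul_sum, Finset.sum_congr rfl fun j _ => h1 j,
        Finset.sum_sub_distrib, Finset.smul_sum]
    rw [hPt i, sub_sub, ← smul_add, smul_sub, smul_comm (M.wE i) h, h2, hp₁]
    module
  have hP' : ∀ i, M.wI i • P i = M.wI i • p₁ + h • ∑ j, M.aI j i • D j := by
    intro i
    have h1 : ∀ j, M.wI i • (M.betaE i j • A j (Pt j) + M.betaI i j • B j (P j))
        = M.wI i • D j - M.aI j i • D j := by
      intro j
      simp only [hD, betaE, betaI]
      match_scalars <;> field_simp [hwI i]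
    have h2 : M.wI i • ((∑ j, M.betaE i j • A j (Pt j)) + ∑ j, M.betaI i j • B j (P j))
        = M.wI i • (∑ j, D j) - ∑ j, M.aI j i • D j := by
      rw [← Finset.sum_add_distrib, Finset.smul_sum, Finset.sum_congr rfl fun j _ => h1 j,
        Finset.sum_sub_distrib, Finset.smul_sum]
    rw [hP i, sub_sub, ← smul_add, smul_sub, smul_comm (M.wI i) h, h2, hp₁]
    module
  have hWD : ∀ i, W i (D i) = M.wE i • W i (A i (p₁ + d)) + M.wI i • W i (B i p₁)
      + h • ∑ j, (M.aE j i • W i (A i (D j)) + M.aI j i • W i (B i (D j))) := by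
    intro i
    have h1 : D i = A i (M.wE i • Pt i) + B i (M.wI i • P i) := by simp [hD]
    rw [h1, hPt', hP', Finset.sum_add_distrib]
    simp only [map_add, map_smul, map_sum]
    module
  have hW₀D : ∀ i, W₀ (D i) = W i (D i)
      - h • ∑ j, (M.aE i j • W j (A j (D i)) + M.aI i j • W j (B j (D i))) := by
    intro i
    have h1 := congrArg (fun L : E →L[ℝ] E => L (D i)) (hW i)
    simp only [add_apply, smul_apply,
      sum_apply, ContinuousLinearMap.comp_apply] at h1
    rw [h1, Finset.sum_add_distrib]
    module
  -- The double sums from `hW₀D` and `hWD` are transposes of each other and cancel.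
  have hsum : ∑ i, W₀ (D i) = ∑ i, M.wE i • W i (A i (p₁ + d)) + ∑ i, M.wI i • W i (B i p₁) := by
    simp_rw [hW₀D, hWD]
    rw [Finset.sum_sub_distrib, Finset.sum_add_distrib, ← Finset.smul_sum, ← Finset.smul_sum,
      Finset.sum_comm, add_sub_cancel_right, Finset.sum_add_distrib]
  have hW₀p : W₀ p₁ = W₀ p₀ - h • ∑ i, W₀ (D i) := by simp [hp₁, map_sum]
  rw [hp₁']
  simp only [add_apply, smul_apply,
    sum_apply, ContinuousLinearMap.comp_apply]
  rw [hW₀p, hsum]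
  simp only [map_add, smul_add, Finset.sum_add_distrib]
  module

end IMEXTableau

/-! ### Local existence and uniqueness for autonomous ODEs -/

section ODE

variable {X : Type*} [NormedAddCommGroup X] [NormedSpace ℝ X]

theorem ContDiff.exists_pos_solution [CompleteSpace X] {F : X → X} (hF : ContDiff ℝ 1 F) (x₀ : X) :
    ∃ δ > 0, ∃ x : ℝ → X, x 0 = x₀ ∧
      ∀ t ∈ Icc 0 δ, HasDerivWithinAt x (F (x t)) (Icc 0 δ) t := by
  obtain ⟨x, hx₀, ε, hε, hx⟩ :=
    hF.contDiffAt.exists_forall_mem_closedBall_exists_eq_forall_mem_Ioo_hasDerivAt₀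
      (x₀ := x₀) 0
  refine ⟨ε / 2, by positivity, x, hx₀, fun t ht => (hx t ?_).hasDerivWithinAt⟩
  constructor <;> linarith [ht.1, ht.2]

/-- `F` is Lipschitz only near the initial value, so uniqueness is taken on a time interval during
which both solutions stay there. -/
theorem ContDiff.exists_pos_eqOn_solutions {F : X → X} (hF : ContDiff ℝ 1 F)
    {x y : ℝ → X} {T : ℝ} (hT : 0 < T)
    (hx : ∀ t ∈ Icc 0 T, HasDerivWithinAt x (F (x t)) (Icc 0 T) t)
    (hy : ∀ t ∈ Icc 0 T, HasDerivWithinAt y (F (y t)) (Icc 0 T) t) (h₀ : x 0 = y 0) :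
    ∃ δ > 0, δ ≤ T ∧ EqOn x y (Icc 0 δ) := by
  obtain ⟨K, s, hs, hK⟩ := (hF.contDiffAt (x := x 0)).exists_lipschitzOnWith
  have h0T : (0 : ℝ) ∈ Icc 0 T := ⟨le_rfl, hT.le⟩
  have ev : ∀ᶠ t in 𝓝[Icc 0 T] (0 : ℝ), x t ∈ s ∧ y t ∈ s :=
    ((hx 0 h0T).continuousWithinAt.eventually hs).and
      ((hy 0 h0T).continuousWithinAt.eventually (h₀ ▸ hs))
  obtain ⟨ε, hε, H⟩ := Metric.mem_nhdsWithin_iff.1 ev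
  have hδT : min T (ε / 2) ≤ T := min_le_left _ _
  have hδε : min T (ε / 2) ≤ ε / 2 := min_le_right _ _
  have mem : ∀ t ∈ Ico 0 (min T (ε / 2)), x t ∈ s ∧ y t ∈ s := fun t ht => H
    ⟨by rw [mem_ball_zero_iff, Real.norm_of_nonneg ht.1]; linarith [ht.2],
      ht.1, by linarith [ht.2]⟩
  have deriv : ∀ {u : ℝ → X}, (∀ t ∈ Icc 0 T, HasDerivWithinAt u (F (u t)) (Icc 0 T) t) →
      ∀ t ∈ Ico 0 (min T (ε / 2)), HasDerivWithinAt u (F (u t)) (Ici t) t := by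
    intro u hu t ht
    exact (hu t ⟨ht.1, by linarith [ht.2]⟩).mono_of_mem_nhdsWithin
      (Filter.mem_of_superset (Icc_mem_nhdsGE (by linarith [ht.2] : t < T))
        (Icc_subset_Icc_left ht.1))
  refine ⟨min T (ε / 2), by positivity, hδT, ?_⟩
  exact ODE_solution_unique_of_mem_Icc_right (v := fun _ => F) (s := fun _ => s)
    (fun _ _ => hK)
    (fun t ht => ((hx t ⟨ht.1, ht.2.trans hδT⟩).continuousWithinAt).mono (Icc_subset_Icc_right hδT))
    (deriv hx) (fun t ht => (mem t ht).1)
    (fun t ht => ((hy t ⟨ht.1, ht.2.trans hδT⟩).continuousWithinAt).mono (Icc_subset_Icc_right hδT))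
    (deriv hy) (fun t ht => (mem t ht).2) h₀

theorem eq_initial_of_hasDerivWithinAt_zero {x : ℝ → X} {T : ℝ}
    (hx : ∀ t ∈ Icc 0 T, HasDerivWithinAt x 0 (Icc 0 T) t) : ∀ t ∈ Icc 0 T, x t = x 0 := by
  refine constant_of_derivWithin_zero (fun t ht => (hx t ht).differentiableWithinAt) fun t ht => ?_
  exact (hx t ⟨ht.1, ht.2.le⟩).derivWithin
    (uniqueDiffOn_Icc (ht.1.trans_lt ht.2) t ⟨ht.1, ht.2.le⟩)

end ODE

/-! ### Solvability of the linear stage equations -/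

/-- A linear system of stage equations is solvable for small step sizes. -/
theorem exists_stages_of_norm_le {ι V : Type*} [Fintype ι] [NormedAddCommGroup V] [NormedSpace ℝ V]
    [FiniteDimensional ℝ V] (L : ι → ι → V →ₗ[ℝ] V) {k h : ℝ} (hk : 0 ≤ k)
    (hL : ∀ i j v, ‖L i j v‖ ≤ k * ‖v‖) (hh : 0 ≤ h) (hhk : h * (Fintype.card ι * k) ≤ 1 / 2)
    (b : ι → V) :
    ∃ x : ι → V, (∀ i, x i = b i + h • ∑ j, L i j (x j)) ∧ ‖x‖ ≤ 2 * ‖b‖ := by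
  obtain ⟨x, hx, hb⟩ := LinearMap.exists_eq_add_smul_of_norm_le
    (LinearMap.pi fun i => ∑ j, L i j ∘ₗ LinearMap.proj j : (ι → V) →ₗ[ℝ] (ι → V))
    (κ := Fintype.card ι * k) (h := h) (fun x => by
      rw [pi_norm_le_iff_of_nonneg (by positivity)]
      intro i
      simp only [LinearMap.pi_apply, LinearMap.sum_apply, LinearMap.comp_apply,
        LinearMap.proj_apply]
      calc ‖∑ j, L i j (x j)‖ ≤ ∑ j : ι, k * ‖x‖ := norm_sum_le_of_le _ fun j _ =>
            (hL i j (x j)).trans (by gcongr; exact norm_le_pi_norm x j)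
        _ = _ := by simp; ring) hh hhk b
  refine ⟨x, fun i => ?_, hb⟩
  have := congrFun hx i
  simpa [LinearMap.pi_apply] using this

theorem contDiff_adjoint_fderiv {m : ℕ} {f : StateSpace m → StateSpace m} (hf : ContDiff ℝ ∞ f) :
    ContDiff ℝ ∞ fun y => ContinuousLinearMap.adjoint (fderiv ℝ f y) := by
  -- The adjoint is conjugate-linear by type; over `ℝ` it is repackaged as a linear map.
  let L : (StateSpace m →L[ℝ] StateSpace m) →ₗ[ℝ] (StateSpace m →L[ℝ] StateSpace m) :=
    { toFun := fun A => ContinuousLinearMap.adjoint A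
      map_add' := by simp
      map_smul' := by simp }
  have hf' : ContDiff ℝ ∞ (fderiv ℝ f) := hf.fderiv_right (by simp)
  exact L.toContinuousLinearMap.contDiff.comp hf'

namespace IMEXTableau

variable {s : ℕ}

/-- A common bound for the coefficients of the forward and the adjoint stages. -/
theorem exists_coeff_bound (M : IMEXTableau s) : ∃ μ, 0 ≤ μ ∧ ∀ i j,
    |M.aE i j| ≤ μ ∧ |M.aI i j| ≤ μ ∧ |M.alphaE i j| ≤ μ ∧ |M.alphaI i j| ≤ μ ∧
      |M.betaE i j| ≤ μ ∧ |M.betaI i j| ≤ μ := by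
  obtain ⟨μ, hμ⟩ := Finite.exists_le fun ij : Fin s × Fin s =>
    |M.aE ij.1 ij.2| + |M.aI ij.1 ij.2| + |M.alphaE ij.1 ij.2| + |M.alphaI ij.1 ij.2| +
      |M.betaE ij.1 ij.2| + |M.betaI ij.1 ij.2|
  refine ⟨max μ 0, le_max_right _ _, fun i j => ?_⟩
  have h1 := (hμ (i, j)).trans (le_max_left μ 0)
  have h2 := abs_nonneg (M.aE i j)
  have h3 := abs_nonneg (M.aI i j)
  have h4 := abs_nonneg (M.alphaE i j)
  have h5 := abs_nonneg (M.alphaI i j)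
  have h6 := abs_nonneg (M.betaE i j)
  have h7 := abs_nonneg (M.betaI i j)
  simp only at h1
  refine ⟨?_, ?_, ?_, ?_, ?_, ?_⟩ <;> linarith

section Stages

variable (M : IMEXTableau s) {E : Type*} [NormedAddCommGroup E] [NormedSpace ℝ E]
  [FiniteDimensional ℝ E]

/-- Both families of stages are coupled, so they are solved for together, as one system indexed by
`Fin s ⊕ Fin s`. -/
theorem exists_adjoint_stages {μ K h : ℝ} (hK : 0 ≤ K) (hμ₀ : 0 ≤ μ)
    (hμ : ∀ i j, |M.alphaE i j| ≤ μ ∧ |M.alphaI i j| ≤ μ ∧ |M.betaE i j| ≤ μ ∧ |M.betaI i j| ≤ μ)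
    {A B : Fin s → E →L[ℝ] E} (hA : ∀ i, ‖A i‖ ≤ K) (hB : ∀ i, ‖B i‖ ≤ K) (hh : 0 ≤ h)
    (hhk : h * ((s + s : ℕ) * (μ * K)) ≤ 1 / 2) (pt₀ p₀ : E) :
    ∃ Pt P : Fin s → E,
      (∀ i, Pt i = pt₀ - h • ∑ j, M.alphaE i j • A j (Pt j) - h • ∑ j, M.alphaI i j • B j (P j)) ∧
      (∀ i, P i = p₀ - h • ∑ j, M.betaE i j • A j (Pt j) - h • ∑ j, M.betaI i j • B j (P j)) := by
  have bound : ∀ {c : ℝ} {L : E →L[ℝ] E}, |c| ≤ μ → ‖L‖ ≤ K → ∀ v,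
      ‖(-(c • L) : E →L[ℝ] E) v‖ ≤ μ * K * ‖v‖ := by
    intro c L hc hL v
    refine (ContinuousLinearMap.le_opNorm _ v).trans ?_
    rw [norm_neg, norm_smul, Real.norm_eq_abs]
    gcongr
  obtain ⟨x, hx, -⟩ := exists_stages_of_norm_le (ι := Fin s ⊕ Fin s) (V := E)
    (Sum.elim
      (fun i => Sum.elim (fun j => (-(M.alphaE i j • A j) : E →L[ℝ] E).toLinearMap)
        (fun j => (-(M.alphaI i j • B j) : E →L[ℝ] E).toLinearMap))
      (fun i => Sum.elim (fun j => (-(M.betaE i j • A j) : E →L[ℝ] E).toLinearMap)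
        (fun j => (-(M.betaI i j • B j) : E →L[ℝ] E).toLinearMap)))
    (mul_nonneg hμ₀ hK)
    (by
      rintro (i | i) (j | j) v
      · exact bound (hμ i j).1 (hA j) v
      · exact bound (hμ i j).2.1 (hB j) v
      · exact bound (hμ i j).2.2.1 (hA j) v
      · exact bound (hμ i j).2.2.2 (hB j) v)
    hh (by simpa using hhk) (Sum.elim (fun _ => pt₀) (fun _ => p₀))
  refine ⟨fun i => x (Sum.inl i), fun i => x (Sum.inr i), fun i => ?_, fun i => ?_⟩
  · have := hx (Sum.inl i)
    simp only [Sum.elim_inl, Fintype.sum_sum_type, Sum.elim_inr, ContinuousLinearMap.coe_coe,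
      neg_apply, smul_apply, Finset.sum_neg_distrib] at this
    refine this.trans ?_
    module
  · have := hx (Sum.inr i)
    simp only [Sum.elim_inl, Fintype.sum_sum_type, Sum.elim_inr, ContinuousLinearMap.coe_coe,
      neg_apply, smul_apply, Finset.sum_neg_distrib] at this
    refine this.trans ?_
    module

theorem exists_fundamental_stages {μ K h : ℝ} (hK : 0 ≤ K) (hμ₀ : 0 ≤ μ)
    (hμ : ∀ i j, |M.aE i j| ≤ μ ∧ |M.aI i j| ≤ μ)
    {A B : Fin s → E →L[ℝ] E} (hA : ∀ i, ‖A i‖ ≤ K) (hB : ∀ i, ‖B i‖ ≤ K) (hh : 0 ≤ h)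
    (hhk : h * (s * (2 * μ * K)) ≤ 1 / 2) :
    ∃ W : Fin s → E →L[ℝ] E,
      (∀ i, W i = ContinuousLinearMap.id ℝ E + h • ∑ j, M.aE i j • (W j ∘L A j)
        + h • ∑ j, M.aI i j • (W j ∘L B j)) ∧ ∀ i, ‖W i‖ ≤ 2 := by
  obtain ⟨W, hW, hn⟩ := exists_stages_of_norm_le (ι := Fin s) (V := E →L[ℝ] E)
    (fun i j => ((ContinuousLinearMap.compL ℝ E E E).flip
      (M.aE i j • A j + M.aI i j • B j)).toLinearMap) (k := 2 * μ * K) (by positivity)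
    (fun i j V => by
      have h1 : ‖M.aE i j • A j + M.aI i j • B j‖ ≤ μ * K + μ * K := by
        refine (norm_add_le _ _).trans ?_
        rw [norm_smul, norm_smul, Real.norm_eq_abs, Real.norm_eq_abs]
        gcongr
        exacts [(hμ i j).1, hA j, (hμ i j).2, hB j]
      calc ‖V ∘L (M.aE i j • A j + M.aI i j • B j)‖
          ≤ ‖V‖ * ‖M.aE i j • A j + M.aI i j • B j‖ := ContinuousLinearMap.opNorm_comp_le _ _
        _ ≤ ‖V‖ * (μ * K + μ * K) := by gcongr
        _ = _ := by ring)
    hh (by simpa using hhk) (fun _ => ContinuousLinearMap.id ℝ E)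
  refine ⟨W, fun i => ?_, fun i => ?_⟩
  · refine (hW i).trans ?_
    simp only [ContinuousLinearMap.coe_coe, ContinuousLinearMap.flip_apply,
      ContinuousLinearMap.compL_apply, ContinuousLinearMap.comp_add, ContinuousLinearMap.comp_smul,
      Finset.sum_add_distrib]
    module
  · have h1 : ‖fun _ : Fin s => ContinuousLinearMap.id ℝ E‖ ≤ 1 :=
      (pi_norm_le_iff_of_nonneg zero_le_one).2 fun _ => ContinuousLinearMap.norm_id_le
    linarith [norm_le_pi_norm W i]

end Stages

/-! ### The augmented system for `(y, W, z)` -/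

section Augmented

variable {E : Type*} [NormedAddCommGroup E] [NormedSpace ℝ E]

/-- Serves for both parts of the splitting: with `f, A, d` for the explicit one, with `g, B, 0` for
the implicit one. -/
theorem contDiff_augmented {f : E → E} {A : E → E →L[ℝ] E}
    (hf : ContDiff ℝ ∞ f) (hA : ContDiff ℝ ∞ A) (d : E) :
    ContDiff ℝ ∞ fun x : E × (E →L[ℝ] E) × E => (f x.1, x.2.1 ∘L A x.1, x.2.1 (A x.1 d)) := by
  have hA' : ContDiff ℝ ∞ fun x : E × (E →L[ℝ] E) × E => A x.1 := hA.comp contDiff_fst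
  have hW : ContDiff ℝ ∞ fun x : E × (E →L[ℝ] E) × E => x.2.1 := contDiff_fst.comp contDiff_snd
  exact (hf.comp contDiff_fst).prodMk
    ((hW.clm_comp hA').prodMk (hW.clm_apply (hA'.clm_apply contDiff_const)))

/-- Along solutions `y` of an ODE, the fundamental matrix `W` of `W' = W (A(y) + B(y))` and the
solution `z` of `z' = W A(y) d` exist for a short time. -/
theorem exists_augmented_solution [CompleteSpace E] {f g : E → E} {A B : E → E →L[ℝ] E}
    (hf : ContDiff ℝ ∞ f) (hg : ContDiff ℝ ∞ g) (hA : ContDiff ℝ ∞ A) (hB : ContDiff ℝ ∞ B)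
    (d : E) {y : ℝ → E} {T : ℝ} (hT : 0 < T)
    (hy : ∀ t ∈ Icc 0 T, HasDerivWithinAt y (f (y t) + g (y t)) (Icc 0 T) t) :
    ∃ δ > 0, δ ≤ T ∧ ∃ (W : ℝ → E →L[ℝ] E) (z : ℝ → E), W 0 = ContinuousLinearMap.id ℝ E ∧
      z 0 = 0 ∧ (∀ t ∈ Icc 0 δ, HasDerivWithinAt y (f (y t) + g (y t)) (Icc 0 δ) t) ∧
      (∀ t ∈ Icc 0 δ, HasDerivWithinAt W (W t ∘L A (y t) + W t ∘L B (y t)) (Icc 0 δ) t) ∧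
      ∀ t ∈ Icc 0 δ, HasDerivWithinAt z (W t (A (y t) d)) (Icc 0 δ) t := by
  have hF := ((contDiff_augmented hf hA d).add
    ((contDiff_augmented hg hB 0))).of_le (m := 1) (by simp)
  obtain ⟨δ₁, hδ₁, x, hx₀, hx⟩ :=
    hF.exists_pos_solution ((y 0, ContinuousLinearMap.id ℝ E, 0) : E × (E →L[ℝ] E) × E)
  have hfst : ∀ t ∈ Icc 0 δ₁, HasDerivWithinAt (fun t => (x t).1)
      (f (x t).1 + g (x t).1) (Icc 0 δ₁) t := fun t ht => (hx t ht).fst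
  have hsnd : ∀ t ∈ Icc 0 δ₁, HasDerivWithinAt (fun t => (x t).2.1)
      ((x t).2.1 ∘L A (x t).1 + (x t).2.1 ∘L B (x t).1) (Icc 0 δ₁) t :=
    fun t ht => (hx t ht).snd.fst
  have hthd : ∀ t ∈ Icc 0 δ₁, HasDerivWithinAt (fun t => (x t).2.2)
      ((x t).2.1 (A (x t).1 d)) (Icc 0 δ₁) t := fun t ht => by
    have h1 : HasDerivWithinAt (fun t => (x t).2.2)
      ((x t).2.1 (A (x t).1 d) + (x t).2.1 (B (x t).1 0)) (Icc 0 δ₁) t := (hx t ht).snd.snd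
    exact h1.congr_deriv (by simp)
  have hsub₁ : Icc 0 (min δ₁ T) ⊆ Icc 0 δ₁ := Icc_subset_Icc_right (min_le_left _ _)
  have hsubT : Icc 0 (min δ₁ T) ⊆ Icc 0 T := Icc_subset_Icc_right (min_le_right _ _)
  -- The augmented flow produces its own first component, which uniqueness identifies with the given
  -- `y`.
  obtain ⟨δ, hδ, hδle, heq⟩ := ((hf.add hg).of_le (m := 1) (by simp)).exists_pos_eqOn_solutions
    (x := y) (y := fun t => (x t).1) (T := min δ₁ T) (by positivity)
    (fun t ht => (hy t (hsubT ht)).mono hsubT) (fun t ht => (hfst t (hsub₁ ht)).mono hsub₁)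
    (by simp [hx₀])
  have hδ₁' : Icc 0 δ ⊆ Icc 0 δ₁ := Icc_subset_Icc_right (hδle.trans (min_le_left _ _))
  have hδT : Icc 0 δ ⊆ Icc 0 T := Icc_subset_Icc_right (hδle.trans (min_le_right _ _))
  refine ⟨δ, hδ, hδle.trans (min_le_right _ _), fun t => (x t).2.1, fun t => (x t).2.2,
    by simp [hx₀], by simp [hx₀], fun t ht => (hy t (hδT ht)).mono hδT, fun t ht => ?_,
    fun t ht => ?_⟩
  · rw [heq ht]
    exact (hsnd t (hδ₁' ht)).mono hδ₁'
  · rw [heq ht]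
    exact (hthd t (hδ₁' ht)).mono hδ₁'

/-- The error of the forward scheme for the fundamental matrix `W` and for `z`. -/
theorem ForwardHasOrder.exists_augmented_error {M : IMEXTableau s} {q : ℕ}
    (hM : M.ForwardHasOrder q) [FiniteDimensional ℝ E] {f g : E → E} {A B : E → E →L[ℝ] E}
    (hf : ContDiff ℝ ∞ f) (hg : ContDiff ℝ ∞ g) (hA : ContDiff ℝ ∞ A) (hB : ContDiff ℝ ∞ B)
    (d : E) {y : ℝ → E} {δ : ℝ} (hδ : 0 < δ) {W : ℝ → E →L[ℝ] E} {z : ℝ → E}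
    (hW₀ : W 0 = ContinuousLinearMap.id ℝ E) (hz₀ : z 0 = 0)
    (hy : ∀ t ∈ Icc 0 δ, HasDerivWithinAt y (f (y t) + g (y t)) (Icc 0 δ) t)
    (hW : ∀ t ∈ Icc 0 δ, HasDerivWithinAt W (W t ∘L A (y t) + W t ∘L B (y t)) (Icc 0 δ) t)
    (hz : ∀ t ∈ Icc 0 δ, HasDerivWithinAt z (W t (A (y t) d)) (Icc 0 δ) t) (R : ℝ) :
    ∃ C, 0 ≤ C ∧ ∀ᶠ h in 𝓝[>] (0 : ℝ), ∀ (Y : Fin s → E) (V : Fin s → E →L[ℝ] E),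
      (∀ i, Y i = y 0 + h • ∑ j, M.aE i j • f (Y j) + h • ∑ j, M.aI i j • g (Y j)) →
      (∀ i, V i = ContinuousLinearMap.id ℝ E + h • ∑ j, M.aE i j • (V j ∘L A (Y j))
        + h • ∑ j, M.aI i j • (V j ∘L B (Y j))) →
      (∀ i, ‖Y i - y 0‖ ≤ R) → (∀ i, ‖V i - ContinuousLinearMap.id ℝ E‖ ≤ R) →
      (∀ i, ‖h • ∑ j, M.aE i j • V j (A (Y j) d)‖ ≤ R) →
        ‖ContinuousLinearMap.id ℝ E + h • ∑ i, M.wE i • (V i ∘L A (Y i))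
          + h • ∑ i, M.wI i • (V i ∘L B (Y i)) - W h‖ ≤ C * h ^ (q + 1) ∧
        ‖h • ∑ i, M.wE i • V i (A (Y i) d) - z h‖ ≤ C * h ^ (q + 1) := by
  obtain ⟨C, hC⟩ := hM.exists_norm_sub_le (X := E × (E →L[ℝ] E) × E)
    (contDiff_augmented hf hA d) (contDiff_augmented hg hB 0) hδ
    (x := fun t => (y t, W t, z t))
    (fun t ht => ((hy t ht).prodMk ((hW t ht).prodMk (hz t ht))).congr_deriv (by simp)) R
  refine ⟨|C|, abs_nonneg C, ?_⟩
  filter_upwards [hC, self_mem_nhdsWithin] with h hh hpos Y V hY hV hYR hVR hZR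
  have hpos' : 0 < h := hpos
  -- The field for `z` does not involve `z`, so its stages are given by a formula.
  have key := hh (fun i => (Y i, V i, h • ∑ j, M.aE i j • V j (A (Y j) d)))
    (fun i => by
      refine Prod.ext ?_ (Prod.ext ?_ ?_)
      · simpa [Prod.fst_sum] using hY i
      · simpa [Prod.fst_sum, Prod.snd_sum, hW₀] using hV i
      · simp [Prod.snd_sum, hz₀])
    (fun i => max_le (hYR i) (max_le
      (by simpa only [Prod.snd_sub, Prod.fst_sub, hW₀] using hVR i)
      (by simpa only [Prod.snd_sub, hz₀, sub_zero] using hZR i)))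
  have key' := key.trans (mul_le_mul_of_nonneg_right (le_abs_self C) (by positivity))
  constructor
  · refine le_trans (le_of_eq ?_) (((norm_fst_le _).trans (norm_snd_le _)).trans key')
    simp [Prod.fst_sum, Prod.snd_sum, hW₀]
  · refine le_trans (le_of_eq ?_) (((norm_snd_le _).trans (norm_snd_le _)).trans key')
    simp [Prod.snd_sum, hz₀]

end Augmented

/-! ### Transfer of the error bound to the adjoint variables -/

/-- The adjoint scheme inherits the order of the forward scheme: the forward scheme applied to the
equation augmented by its transposed fundamental matrix determines the adjoint variables. -/
theorem ForwardHasOrder.combinedHasOrder {M : IMEXTableau s} (hwE : ∀ i, M.wE i ≠ 0)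
    (hwI : ∀ i, M.wI i ≠ 0) {q : ℕ} (hM : M.ForwardHasOrder q) : M.CombinedHasOrder q := by
  intro m f g hf hg T y pt p hT ⟨hy, hpt, hp⟩ r hr
  let A : StateSpace m → StateSpace m →L[ℝ] StateSpace m :=
    fun y => ContinuousLinearMap.adjoint (fderiv ℝ f y)
  let B : StateSpace m → StateSpace m →L[ℝ] StateSpace m :=
    fun y => ContinuousLinearMap.adjoint (fderiv ℝ g y)
  have hA : ContDiff ℝ ∞ A := contDiff_adjoint_fderiv hf
  have hB : ContDiff ℝ ∞ B := contDiff_adjoint_fderiv hg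
  have hp' : ∀ t ∈ Icc 0 T, HasDerivWithinAt p (-A (y t) (pt t) - B (y t) (p t)) (Icc 0 T) t := hp
  obtain ⟨d, hd₀⟩ : ∃ d, pt 0 = p 0 + d := ⟨pt 0 - p 0, by abel⟩
  have hd : ∀ t ∈ Icc 0 T, pt t = p t + d := by
    intro t ht
    have := eq_initial_of_hasDerivWithinAt_zero (x := fun t => pt t - p t)
      (fun t ht => ((hpt t ht).sub (hp t ht)).congr_deriv (sub_self _)) t ht
    simp only [hd₀, add_sub_cancel_left] at this
    rw [← this]; abel
  obtain ⟨δ, hδ, hδT, W, z, hW₀, hz₀, hyδ, hW, hz⟩ :=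
    exists_augmented_solution hf hg hA hB d hT hy
  have hsub : Icc 0 δ ⊆ Icc 0 T := Icc_subset_Icc_right hδT
  have pairing : ∀ t ∈ Icc 0 δ, W t (p t) + z t = p 0 := by
    intro t ht
    have := eq_initial_of_hasDerivWithinAt_zero (x := fun t => W t (p t) + z t)
      (fun t ht => by
        have h1 := ((hW t ht).clm_apply ((hp' t (hsub ht)).mono hsub)).add (hz t ht)
        refine h1.congr_deriv ?_
        rw [hd t (hsub ht)]
        simp only [add_apply, ContinuousLinearMap.comp_apply, map_sub, map_neg, map_add]
        abel) t ht
    simpa [hW₀, hz₀] using this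
  obtain ⟨μ, hμ₀, hμ⟩ := M.exists_coeff_bound
  obtain ⟨KA, hKA⟩ := (isCompact_closedBall (y 0) r).exists_bound_of_continuousOn
    hA.continuous.continuousOn
  obtain ⟨KB, hKB⟩ := (isCompact_closedBall (y 0) r).exists_bound_of_continuousOn
    hB.continuous.continuousOn
  obtain ⟨K, hK₀, hAK, hBK⟩ : ∃ K, 0 ≤ K ∧ KA ≤ K ∧ KB ≤ K :=
    ⟨max 0 (max KA KB), le_max_left _ _, (le_max_left _ _).trans (le_max_right _ _),
      (le_max_right _ _).trans (le_max_right _ _)⟩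
  have bounds : ∀ Y : Fin s → StateSpace m, (∀ i, Y i ∈ Metric.ball (y 0) r) →
      (∀ i, ‖A (Y i)‖ ≤ K) ∧ ∀ i, ‖B (Y i)‖ ≤ K := fun Y hY =>
    ⟨fun i => (hKA _ (Metric.ball_subset_closedBall (hY i))).trans hAK,
      fun i => (hKB _ (Metric.ball_subset_closedBall (hY i))).trans hBK⟩
  -- Radius for all augmented stages: `r` for `Y`, `3 = 2 + 1` for `V - id`, and the last bound for
  -- the `z` stages when `h ≤ 1`.
  obtain ⟨R, hRr, hR3, hRz⟩ : ∃ R, r ≤ R ∧ 3 ≤ R ∧ s * (μ * (2 * (K * ‖d‖))) ≤ R :=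
    ⟨max r (max 3 (s * (μ * (2 * (K * ‖d‖))))), le_max_left _ _,
      (le_max_left _ _).trans (le_max_right _ _), (le_max_right _ _).trans (le_max_right _ _)⟩
  obtain ⟨C₀, hC₀⟩ := hM m f g hf hg T y hT hy r hr
  obtain ⟨C₁, hC₁₀, hC₁⟩ :=
    hM.exists_augmented_error hf hg hA hB d hδ hW₀ hz₀ hyδ hW hz R
  have small : ∀ c : ℝ, ∀ ε > 0, ∀ᶠ h in 𝓝[>] (0 : ℝ), h * c ≤ ε := fun c ε hε => by
    have h1 : Tendsto (fun h : ℝ => h * c) (𝓝[>] 0) (𝓝 0) := by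
      have : Tendsto (fun h : ℝ => h * c) (𝓝 0) (𝓝 (0 * c)) := tendsto_id.mul_const c
      rw [zero_mul] at this
      exact this.mono_left nhdsWithin_le_nhds
    exact (h1.eventually (gt_mem_nhds hε)).mono fun _ => le_of_lt
  have hle : 𝓝[>] (0 : ℝ) ≤ 𝓝[Icc 0 δ] 0 := by
    rw [← nhdsWithin_Ioc_eq_nhdsGT hδ]
    exact nhdsWithin_mono _ Ioc_subset_Icc_self
  -- Together with `C₁ h ≤ 1/4` this puts the numerical `V₁` within `1/2` of `id`.
  have evW : ∀ᶠ h in 𝓝[>] (0 : ℝ), ‖W h - ContinuousLinearMap.id ℝ (StateSpace m)‖ < 1 / 4 := by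
    have h1 : Tendsto W (𝓝[>] 0) (𝓝 (W 0)) :=
      (hW 0 ⟨le_rfl, hδ.le⟩).continuousWithinAt.tendsto.mono_left hle
    rw [hW₀] at h1
    filter_upwards [h1.eventually (Metric.ball_mem_nhds _ (by norm_num : (0 : ℝ) < 1 / 4))]
      with h hh using mem_ball_iff_norm.1 hh
  have evp : ∀ᶠ h in 𝓝[>] (0 : ℝ), ‖p h‖ < ‖p 0‖ + 1 := by
    have h1 : Tendsto p (𝓝[>] 0) (𝓝 (p 0)) :=
      ((hp 0 ⟨le_rfl, hT.le⟩).continuousWithinAt.mono hsub).tendsto.mono_left hle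
    exact h1.norm.eventually (gt_mem_nhds (by linarith))
  have ev1 : ∀ᶠ h in 𝓝[>] (0 : ℝ), h ∈ Ioc 0 (min δ 1) := Ioc_mem_nhdsGT (by positivity)
  -- The factor 2 comes from inverting `V₁`; `‖p 0‖ + 2` is the bound `‖p 0‖ + 1` on `‖p h‖`, for
  -- the error of `W`, plus 1 for that of `z`.
  refine ⟨max C₀ (2 * (C₁ * (‖p 0‖ + 2))), ?_⟩
  filter_upwards [hC₀, hC₁, evW, evp, ev1, small ((s + s : ℕ) * (μ * K)) (1 / 2) (by norm_num),
    small (s * (2 * μ * K)) (1 / 2) (by norm_num), small C₁ (1 / 4) (by norm_num)]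
    with h hfwd haug hWh hph hh1 hsm₁ hsm₂ hsm₃
  have hh : 0 < h := hh1.1
  have hhδ : h ∈ Icc 0 δ := ⟨hh.le, hh1.2.trans (min_le_left _ _)⟩
  have hh_one : h ≤ 1 := hh1.2.trans (min_le_right _ _)
  have hpow : 0 ≤ h ^ (q + 1) := by positivity
  refine ⟨?_, fun Y Pt P hY hYr hP => ?_⟩
  · obtain ⟨Y, hY, hYr⟩ := hfwd.1
    obtain ⟨Pt, P, hPt, hP⟩ := M.exists_adjoint_stages hK₀ hμ₀
      (fun i j => ⟨(hμ i j).2.2.1, (hμ i j).2.2.2.1, (hμ i j).2.2.2.2.1, (hμ i j).2.2.2.2.2⟩)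
      (bounds Y hYr).1 (bounds Y hYr).2 hh.le hsm₁ (pt 0) (p 0)
    exact ⟨Y, Pt, P, hY, hYr, hPt, hP⟩
  have herr : ‖M.adjointUpdate f g h (p 0) Y Pt P - p h‖ ≤
      2 * (C₁ * (‖p 0‖ + 2)) * h ^ (q + 1) := by
    obtain ⟨V, hV, hV2⟩ := M.exists_fundamental_stages hK₀ hμ₀
      (fun i j => ⟨(hμ i j).1, (hμ i j).2.1⟩) (bounds Y hYr).1 (bounds Y hYr).2 hh.le hsm₂
    obtain ⟨hV₁W, hz₁z⟩ := haug Y V hY hV (fun i => (mem_ball_iff_norm.1 (hYr i)).le.trans hRr)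
      (fun i => by
        have h1 : ‖ContinuousLinearMap.id ℝ (StateSpace m)‖ ≤ 1 := ContinuousLinearMap.norm_id_le
        linarith [norm_sub_le (V i) (ContinuousLinearMap.id ℝ (StateSpace m)), hV2 i])
      (fun i => by
        rw [norm_smul, Real.norm_of_nonneg hh.le]
        have h1 : ‖∑ j, M.aE i j • V j (A (Y j) d)‖ ≤ ∑ _j : Fin s, μ * (2 * (K * ‖d‖)) := by
          refine norm_sum_le_of_le _ fun j _ => ?_
          rw [norm_smul, Real.norm_eq_abs]
          refine mul_le_mul (hμ i j).1 ?_ (norm_nonneg _) hμ₀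
          refine (V j).le_of_opNorm_le_of_le (hV2 j) ?_
          exact (A (Y j)).le_of_opNorm_le ((bounds Y hYr).1 j) d
        rw [Finset.sum_const, Finset.card_univ, Fintype.card_fin, nsmul_eq_mul] at h1
        exact (mul_le_of_le_one_left (norm_nonneg _) hh_one).trans (h1.trans hRz))
    set V₁ : StateSpace m →L[ℝ] StateSpace m := ContinuousLinearMap.id ℝ _
      + h • ∑ i, M.wE i • (V i ∘L A (Y i)) + h • ∑ i, M.wI i • (V i ∘L B (Y i)) with hV₁
    set z₁ : StateSpace m := h • ∑ i, M.wE i • V i (A (Y i) d) with hz₁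
    have hdisc : V₁ (M.adjointUpdate f g h (p 0) Y Pt P) + z₁ = p 0 :=
      M.adjoint_pairing_eq hwE hwI (A := fun i => A (Y i)) (B := fun i => B (Y i)) hV
        (fun i => by rw [← hd₀]; exact hP.1 i) hP.2
    set e := M.adjointUpdate f g h (p 0) Y Pt P - p h with he
    -- Difference of the discrete and the exact conservation law.
    have hVe : V₁ e = -((V₁ - W h) (p h)) - (z₁ - z h) := by
      have h1 := pairing h hhδ
      rw [he, map_sub, eq_sub_of_add_eq hdisc, ← h1, sub_apply]
      abel
    have hVe' : ‖V₁ e‖ ≤ C₁ * h ^ (q + 1) * (‖p 0‖ + 2) := by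
      rw [hVe]
      refine (norm_sub_le _ _).trans ?_
      rw [norm_neg]
      have h1 := (V₁ - W h).le_of_opNorm_le_of_le hV₁W hph.le
      linarith
    have hpow_le : h ^ (q + 1) ≤ h := by
      simpa using pow_le_pow_of_le_one hh.le hh_one (Nat.le_add_left 1 q)
    have hV₁id : ‖ContinuousLinearMap.id ℝ (StateSpace m) - V₁‖ ≤ 1 / 2 := by
      have h1 : C₁ * h ^ (q + 1) ≤ 1 / 4 := by
        calc C₁ * h ^ (q + 1) ≤ C₁ * h := by gcongr
          _ = h * C₁ := mul_comm _ _
          _ ≤ _ := hsm₃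
      have h2 := norm_sub_le_norm_sub_add_norm_sub V₁ (W h) (ContinuousLinearMap.id ℝ (StateSpace m))
      rw [norm_sub_rev]
      linarith
    have h1 : ‖e‖ ≤ ‖V₁ e‖ + 1 / 2 * ‖e‖ := by
      have h2 : e = V₁ e + (ContinuousLinearMap.id ℝ (StateSpace m) - V₁) e := by simp
      calc ‖e‖ = ‖V₁ e + (ContinuousLinearMap.id ℝ (StateSpace m) - V₁) e‖ := by rw [← h2]
        _ ≤ _ := (norm_add_le _ _).trans
          (by gcongr; exact ContinuousLinearMap.le_of_opNorm_le _ hV₁id e)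
    linarith
  have hfinal : ‖M.adjointUpdate f g h (p 0) Y Pt P - p h‖ ≤
      max C₀ (2 * (C₁ * (‖p 0‖ + 2))) * h ^ (q + 1) :=
    herr.trans (by gcongr; exact le_max_right _ _)
  refine ⟨(hfwd.2 Y hY hYr).trans (by gcongr; exact le_max_left _ _), ?_, hfinal⟩
  -- Both variables receive the same increment, so numerically too they differ by `d`.
  have hdiff : M.adjointUpdate f g h (pt 0) Y Pt P - pt h
      = M.adjointUpdate f g h (p 0) Y Pt P - p h := by
    rw [hd h (hsub hhδ), hd₀]
    simp only [adjointUpdate]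
    abel
  rw [hdiff]
  exact hfinal

end IMEXTableau

theorem theorem1 {s : ℕ} (M : IMEXTableau s) (hwE : ∀ i, M.wE i ≠ 0) (hwI : ∀ i, M.wI i ≠ 0) :
    (M.ForwardHasOrder 1 → M.CombinedHasOrder 1) ∧
    (M.ForwardHasOrder 2 → M.CombinedHasOrder 2) ∧
    (M.ForwardHasOrder 3 →
      ((∑ i, M.wI i * M.gammaI i ^ 2 = 1 / 3 ∧
        ∑ i, M.wI i * M.gammaE i ^ 2 = 1 / 3 ∧
        ∑ i, M.wI i * M.gammaI i * M.gammaE i = 1 / 3) ∨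
       (∑ i, ∑ j, M.wI i * M.aI i j * M.gammaI j = 1 / 6 ∧
        ∑ i, ∑ j, M.wI i * M.aE i j * M.gammaE j = 1 / 6 ∧
        (∑ i, ∑ j, M.wI i * M.aI i j * M.gammaE j = 1 / 6 ∨
         ∑ i, ∑ j, M.wI i * M.aE i j * M.gammaI j = 1 / 6))) →
      M.CombinedHasOrder 3) :=
  ⟨fun h => h.combinedHasOrder hwE hwI, fun h => h.combinedHasOrder hwE hwI,
    fun h _ => h.combinedHasOrder hwE hwI⟩
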